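/- **Conventions.** Fix a universe $\mathfrak U$; sets and sets of morphisms are $\mathfrak U$-small, and presheaves and sheaves are sheaves of ($\mathfrak U$-small) sets. For a Grothendieck topology $J$ on a category $\mathcal C$, let $\mathcal T(J)$ be the collection of morphisms $f:Y\to X$ such that the sieve on $X$ generated by $f$ is $J$-covering, and let $\mathcal C(\mathcal T(J))$ be the subcategory of $\mathcal C$ with the same objects and with the morphisms in $\mathcal T(J)$. A collection $\mathcal T$ of morphisms is *semi-localizing* if it contains the identities, is closed under composition, and for every $f_1:Y_1\to X$ in $\mathcal T$ and every $f_2:Y_2\to X$ there are $g_1:Z\to Y_1$ and $g_2:Z\to Y_2$ with $g_2\in\mathcal T$ and $f_1g_1=f_2g_2$. $J$ is an *$A$-topology* if for some semi-localizing $\mathcal T$ the covering sieves are exactly the sieves containing a morphism of $\mathcal T$. A map $\phi:S\to S'$ from a set with a left action of a group $G$ is a *pseudo $G$-torsor* if $\phi$ is $G$-invariant, $G$ acts freely on $S$, and the induced map $G\backslash S\to S'$ is injective. A morphism $f:Y\to X$ is a *Galois covering* if there are a group $G$ and a homomorphism $\rho:G\to\mathrm{Aut}_X(Y)$ such that for every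 $Z$ the map $\mathrm{Hom}(Z,Y)\to\mathrm{Hom}(Z,X)$, $h\mapsto fh$, is a pseudo $G$-torsor, where $g\in G$ acts by $h\mapsto\rho(g)h$. For a collection $\mathcal T$ put $\widehat{\mathcal T}=\{f : fg\in\mathcal T\text{ for some }g\}$; $\mathcal T$ *has enough Galois coverings* if $\widehat{\mathcal T'}=\widehat{\mathcal T}$, where $\mathcal T'$ is the collection of Galois coverings that belong to $\mathcal T$. A category is *$\Lambda$-connected* if any two of its objects receive morphisms from a common object. A *$Y$-site* $(\mathcal C,J)$ is an essentially $\mathfrak U$-small category $\mathcal C$ in which every morphism is an epimorphism, with an $A$-topology $J$ such that $gf\in\mathcal T(J)$ if and only if $f,g\in\mathcal T(J)$ (for all composable $f,g$), $\mathcal C(\mathcal T(J))$ is $\Lambda$-connected, and $\mathcal T(J)$ has enough Galois coverings. A *grid* of $(\mathcal C,J)$ is a $\mathfrak U$-small $\Lambda$-connected poset $\mathcal C_0$ (regarded as a category, with one morphism $x\to y$ if $x\le y$) with a functor $\iota_0:\mathcal C_0\to\mathcal C$ such that: (a) every object of $\mathcal C$ is isomorphic to $\iota_0(X)$ for some *edge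 object* $X$, i.e. an object $X$ of $\mathcal C_0$ such that $\iota_0(f)\in\mathcal T(J)$ for every morphism $f$ with target $X$; (b) for every object $X$ of $\mathcal C_0$ and every $f:Y\to\iota_0(X)$ in $\mathcal T(J)$ there are $f':Y'\to X$ in $\mathcal C_0$ and an isomorphism $\alpha:Y\cong\iota_0(Y')$ with $f=\iota_0(f')\alpha$; (c) for every object $X$ of $\mathcal C_0$ the functor of undercategories $\mathcal C_{0,X/}\to\mathcal C_{\iota_0(X)/}$ induced by $\iota_0$ is an equivalence. The *fiber functor* of a grid sends a presheaf $F$ on $\mathcal C$ to $\omega(F)=\varinjlim_X F(\iota_0(X))$, where $X$ runs over the edge objects. A *point* of a topos $E$ is a pair $(F_*,F^*)$ of functors $F_*:\mathrm{Sets}\to E$ and $F^*:E\to\mathrm{Sets}$ such that $F^*$ is left adjoint to $F_*$ and preserves finite limits. $E$ *has enough points* if there is a ($\mathfrak U$-small) family of points whose functors $F^*$ jointly reflect isomorphisms. **Theorem.** Let $(\mathcal C,J)$ be a $Y$-site. Assume that, for every object $X$ of $\mathcal C$, the category $\mathcal D=\mathcal C(\mathcal T(J))_{/X}$ satisfies at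 least one of the following conditions: (1) all sets $\mathrm{Hom}_{\mathcal D}(A,B)$ are finite; (2) there is an at most countable set $S$ of objects of $\mathcal D$ such that every object of $\mathcal D$ receives a morphism from an object in $S$. (i) Suppose that $\mathcal C$ is non-empty and let $(\mathcal C_0,\iota_0)$ be a grid of $(\mathcal C,J)$, with fiber functor $\omega$. Let $F^*$ be the restriction of $\omega$ to $\mathrm{Shv}(\mathcal C,J)$, and for a set $Y$ let $F_*(Y)$ be the presheaf $X\mapsto\mathrm{Map}(\omega(\mathrm{Hom}_{\mathcal C}(-,X)),Y)$. Then $F^*$ preserves finite limits, $F_*(Y)$ is a sheaf for every set $Y$, the functor $F_*:\mathrm{Sets}\to\mathrm{Shv}(\mathcal C,J)$ is right adjoint to $F^*$, and $(F_*,F^*)$ is a point of the topos $\mathrm{Shv}(\mathcal C,J)$. (ii) The topos $\mathrm{Shv}(\mathcal C,J)$ has enough points. -/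

import Mathlib

open CategoryTheory Limits Opposite

universe w u

/-! ### Semi-localizing collections and `A`-topologies -/

/-- A collection `T` of morphisms is semi-localizing if it contains the identities, is closed
under composition and satisfies the right Ore condition. -/
structure IsSemiLocalizing {C : Type u} [Category.{w} C] (T : MorphismProperty C) : Prop where
  id_mem : ∀ X : C, T (𝟙 X)
  comp_mem : ∀ {X Y Z : C} (f : X ⟶ Y) (g : Y ⟶ Z), T f → T g → T (f ≫ g)
  ore : ∀ {X Y₁ Y₂ : C} (f₁ : Y₁ ⟶ X) (f₂ : Y₂ ⟶ X), T f₁ →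
    ∃ (Z : C) (g₁ : Z ⟶ Y₁) (g₂ : Z ⟶ Y₂), T g₂ ∧ g₁ ≫ f₁ = g₂ ≫ f₂

/-- `J` is an `A`-topology if there is a semi-localizing collection `T` such that the covering
sieves of `J` are exactly the sieves which contain a morphism that belongs to `T`. -/
def IsATopology {C : Type u} [Category.{w} C] (J : GrothendieckTopology C) : Prop :=
  ∃ T : MorphismProperty C, IsSemiLocalizing T ∧
    ∀ (X : C) (R : Sieve X), R ∈ J X ↔ ∃ (Y : C) (f : Y ⟶ X), R f ∧ T f

/-- The collection `𝒯(J)` of the morphisms `f : Y ⟶ X` such that the sieve on `X` generated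
by `f` is a covering sieve. -/
def coveringMorphisms {C : Type u} [Category.{w} C] (J : GrothendieckTopology C) :
    MorphismProperty C :=
  fun _ X f => Sieve.generate (Presieve.singleton f) ∈ J X

instance coveringMorphisms_isMultiplicative {C : Type u} [Category.{w} C]
    (J : GrothendieckTopology C) : (coveringMorphisms J).IsMultiplicative where
  id_mem X := by
    refine J.superset_covering ?_ (J.top_mem X)
    intro Y f _
    exact ⟨X, f, 𝟙 X, Presieve.singleton_self _, by simp⟩
  comp_mem {X Y Z} f g hf hg := by
    refine J.transitive hg _ ?_
    rintro W h ⟨Y', a, b, hb, rfl⟩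
    cases hb
    refine J.superset_covering ?_ (J.pullback_stable a hf)
    rintro V c ⟨X', d, e, he, hde⟩
    cases he
    exact ⟨X, d, f ≫ g, Presieve.singleton_self _, by
      simp only [← Category.assoc, hde]⟩

/-- The category `𝒞(𝒯(J))`: same objects as `C`, and those morphisms which belong
to `𝒯(J)`. -/
abbrev CoveringCategory {C : Type u} [Category.{w} C] (J : GrothendieckTopology C) : Type u :=
  WideSubcategory (coveringMorphisms J)

/-! ### Galois coverings -/

/-- A map `φ : S → S'` from a `G`-set `S` is a pseudo `G`-torsor if it is `G`-invariant, `G`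
acts freely on `S`, and the induced map `G \ S → S'` is injective. -/
structure IsPseudoTorsor (G : Type*) [Group G] {S S' : Type*} [MulAction G S]
    (φ : S → S') : Prop where
  invariant : ∀ (g : G) (s : S), φ (g • s) = φ s
  free : ∀ (g : G) (s : S), g • s = s → g = 1
  injective : ∀ s t : S, φ s = φ t → ∃ g : G, g • s = t

/-- The action on `Hom(Z, Y)` by composition, of a group `G` that is sent by `ρ` to the group
`Aut_X(Y)` of automorphisms of `Y` over `X`. -/
abbrev homMulAction {C : Type u} [Category.{w} C] {X Y : C} {f : Y ⟶ X} {G : Type*} [Group G]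
    (ρ : G →* Aut (Over.mk f)) (Z : C) : MulAction G (Z ⟶ Y) where
  smul g h := h ≫ (ρ g).hom.left
  one_smul h := by
    change h ≫ (ρ 1).hom.left = h
    rw [map_one]
    exact Category.comp_id h
  mul_smul g g' h := by
    change h ≫ (ρ (g * g')).hom.left = (h ≫ (ρ g').hom.left) ≫ (ρ g).hom.left
    rw [map_mul, Category.assoc]
    rfl

/-- A morphism `f : Y ⟶ X` is a Galois covering if there are a group `G` and a homomorphism
`G → Aut_X(Y)` such that, for every `Z`, composition with `f` makes `Hom(Z, Y) → Hom(Z, X)`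
a pseudo `G`-torsor. -/
def IsGaloisCovering {C : Type u} [Category.{w} C] {X Y : C} (f : Y ⟶ X) : Prop :=
  ∃ (G : Type w) (_ : Group G) (ρ : G →* Aut (Over.mk f)), ∀ Z : C,
    @IsPseudoTorsor G _ (Z ⟶ Y) (Z ⟶ X) (homMulAction ρ Z) (fun h => h ≫ f)

/-- For a collection `T`, the collection of the morphisms `f` such that `g ≫ f ∈ T` for
some `g`. -/
def dominated {C : Type u} [Category.{w} C] (T : MorphismProperty C) : MorphismProperty C :=
  fun Y _ f => ∃ (Z : C) (g : Z ⟶ Y), T (g ≫ f)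

/-- `T` has enough Galois coverings: `T` and the collection of the Galois coverings in `T`
dominate the same morphisms. -/
def HasEnoughGaloisCoverings {C : Type u} [Category.{w} C] (T : MorphismProperty C) : Prop :=
  dominated (fun _ _ f => T f ∧ IsGaloisCovering f) = dominated T

/-! ### `Y`-sites and the cardinality conditions -/

/-- A category is `Λ`-connected if any two objects receive morphisms from a common object. -/
def IsLambdaConnected (D : Type*) [Category* D] : Prop :=
  ∀ X Y : D, ∃ Z : D, Nonempty (Z ⟶ X) ∧ Nonempty (Z ⟶ Y)

/-- `B`-sites. -/
structure IsBSite {C : Type u} [Category.{w} C] (J : GrothendieckTopology C) : Prop where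
  epi : ∀ {X Y : C} (f : X ⟶ Y), Epi f
  isATopology : IsATopology J
  comp_mem_iff : ∀ {X Y Z : C} (g : Z ⟶ Y) (f : Y ⟶ X),
    coveringMorphisms J (g ≫ f) ↔ coveringMorphisms J f ∧ coveringMorphisms J g

/-- `Y`-sites. Smallness is relative to the universe `w`; the category `C` has `w`-small sets of
morphisms. -/
structure IsYSite {C : Type u} [Category.{w} C] (J : GrothendieckTopology C) : Prop
    extends IsBSite J where
  essentiallySmall : EssentiallySmall.{w} C
  isLambdaConnected : IsLambdaConnected (CoveringCategory J)
  enoughGalois : HasEnoughGaloisCoverings (coveringMorphisms J)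

/-- First cardinality condition: all sets of morphisms are finite. -/
def HasFiniteHoms (D : Type*) [Category* D] : Prop :=
  ∀ X Y : D, Finite (X ⟶ Y)

/-- Second cardinality condition: there is an at most countable set of objects such that every
object receives a morphism from one of them. -/
def HasCountableCoinitialSet (D : Type*) [Category* D] : Prop :=
  ∃ S : Set D, S.Countable ∧ ∀ X : D, ∃ Y ∈ S, Nonempty (Y ⟶ X)

/-! ### Grids and their fiber functors -/

/-- The edge objects of `C₀`: the objects `X` such that `ι₀` sends every morphism to `X` into
`𝒯(J)`. -/
def edgeObjects {C : Type u} [Category.{w} C] (J : GrothendieckTopology C)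
    {C₀ : Type w} [PartialOrder C₀] (ι₀ : C₀ ⥤ C) : ObjectProperty C₀ :=
  fun X => ∀ (Y : C₀) (f : Y ⟶ X), coveringMorphisms J (ι₀.map f)

/-- Grids of a site: here `C₀` is a (`w`-small) poset regarded as a category, with a unique
morphism from `x` to `y` if `x ≤ y` and none otherwise. -/
structure IsGrid {C : Type u} [Category.{w} C] (J : GrothendieckTopology C)
    {C₀ : Type w} [PartialOrder C₀] (ι₀ : C₀ ⥤ C) : Prop where
  isLambdaConnected : IsLambdaConnected C₀
  exists_edge : ∀ X' : C, ∃ X : C₀, edgeObjects J ι₀ X ∧ Nonempty (ι₀.obj X ≅ X')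
  exists_lift : ∀ (X : C₀) (Y : C) (f : Y ⟶ ι₀.obj X), coveringMorphisms J f →
    ∃ (Y' : C₀) (f' : Y' ⟶ X) (α : Y ≅ ι₀.obj Y'), f = α.hom ≫ ι₀.map f'
  under_isEquivalence : ∀ X : C₀, (Under.post (X := X) ι₀).IsEquivalence

/-- The fiber functor `ω` on presheaves: `ω(F)` is the colimit of the sets `F(ι₀(X))`, where `X`
runs over the edge objects. -/
noncomputable def fiberFunctor {C : Type u} [Category.{w} C] (J : GrothendieckTopology C)
    {C₀ : Type w} [PartialOrder C₀] (ι₀ : C₀ ⥤ C) : (Cᵒᵖ ⥤ Type w) ⥤ Type w :=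
  (Functor.whiskeringLeft _ _ (Type w)).obj ((edgeObjects J ι₀).ι ⋙ ι₀).op ⋙ colim

/-- The restriction `F^*` of the fiber functor to sheaves. -/
noncomputable def sheafFiberFunctor {C : Type u} [Category.{w} C] (J : GrothendieckTopology C)
    {C₀ : Type w} [PartialOrder C₀] (ι₀ : C₀ ⥤ C) : Sheaf J (Type w) ⥤ Type w :=
  sheafToPresheaf J (Type w) ⋙ fiberFunctor J ι₀

/-- The functor `F_*` with values in presheaves: `F_*(Y)(X)` is the set of maps from
`ω(Hom(-, X))` to `Y`. -/
noncomputable def directImagePresheaf {C : Type u} [Category.{w} C] (J : GrothendieckTopology C)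
    {C₀ : Type w} [PartialOrder C₀] (ι₀ : C₀ ⥤ C) : Type w ⥤ (Cᵒᵖ ⥤ Type w) :=
  yoneda ⋙ (Functor.whiskeringLeft _ _ _).obj (yoneda ⋙ fiberFunctor J ι₀).op

/-- The functor `F_*` with values in sheaves, given that its values are sheaves. -/
noncomputable def directImageSheaf {C : Type u} [Category.{w} C] (J : GrothendieckTopology C)
    {C₀ : Type w} [PartialOrder C₀] (ι₀ : C₀ ⥤ C)
    (h : ∀ Y : Type w, Presheaf.IsSheaf J ((directImagePresheaf J ι₀).obj Y)) :
    Type w ⥤ Sheaf J (Type w) :=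
  ObjectProperty.lift _ (directImagePresheaf J ι₀) h

/-! ### Points of a topos -/

/-- A point of a topos `E`: a geometric morphism from the topos of sets to `E`, i.e. a functor
`E ⥤ Type w` which preserves finite limits, with a right adjoint. -/
structure ToposPoint (E : Type*) [Category* E] where
  inverseImage : E ⥤ Type w
  directImage : Type w ⥤ E
  adj : inverseImage ⊣ directImage
  preservesFiniteLimits : PreservesFiniteLimits inverseImage

/-- A topos has enough points if there is a (`w`-small) family of points whose inverse image
functors jointly reflect isomorphisms. -/
def ToposHasEnoughPoints (E : Type*) [Category* E] : Prop :=
  ∃ (I : Type w) (p : I → ToposPoint.{w} E),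
    JointlyReflectIsomorphisms fun i => (p i).inverseImage

/-! Both statements rest on one construction. A cofiltered diagram `ι : P ⥤ C` gives a stalk
functor, exact because filtered colimits of sets commute with finite limits, with skyscraper
presheaves as right adjoint. If every covering sieve on `ι(E)` contains some `ι(u)`, stalks invert
inclusions of covering sieves; by adjunction skyscrapers are sheaves, and one gets a point
(`stalkPoint`). For the edge objects of a grid this condition is the lifting axiom, which gives (i).

For (ii) no grid is needed. For each `X` one seeks a cofiltered diagram of Galois coverings of `X`,
coinitial among its covering morphisms (`exists_coinitial_diagram`). The difficulty is to choose
compatible transition morphisms: a countable coinitial set allows a sequence, and finite sets of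
morphisms allow a compactness argument with an ultrafilter. Normality then upgrades coinitiality to
the sieve condition (`exists_map_eq_of_normal`).

All transition morphisms being covering, sections of a sheaf inject into the stalk. So a morphism
bijective on stalks is injective and locally surjective on sections over `X`, and the points for all
`X` in a small model are jointly conservative. -/

/-! ### Stalk functors along cofiltered diagrams -/

section Stalk

variable {C : Type u} [Category.{w} C] {P : Type w} [SmallCategory P] (ι : P ⥤ C)

/-- The functor which sends a presheaf `F` to the colimit of the sets `F(ι(E))`. -/
noncomputable def stalkFunctor : (Cᵒᵖ ⥤ Type w) ⥤ Type w :=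
  (Functor.whiskeringLeft _ _ (Type w)).obj ι.op ⋙ colim

/-- The right adjoint of the stalk functor. -/
noncomputable def skyscraperFunctor : Type w ⥤ (Cᵒᵖ ⥤ Type w) :=
  yoneda ⋙ (Functor.whiskeringLeft _ _ _).obj (yoneda ⋙ stalkFunctor ι).op

variable {ι}

/-- The class in the stalk of a section over `ι(E)`. -/
noncomputable def germ {F : Cᵒᵖ ⥤ Type w} (E : P) (x : F.obj (op (ι.obj E))) :
    (stalkFunctor ι).obj F :=
  colimit.ι (ι.op ⋙ F) (op E) x

lemma germ_surjective {F : Cᵒᵖ ⥤ Type w} (s : (stalkFunctor ι).obj F) :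
    ∃ (E : P) (x : F.obj (op (ι.obj E))), germ E x = s := by
  obtain ⟨E, x, h⟩ := Types.jointly_surjective' (F := ι.op ⋙ F) s
  exact ⟨E.unop, x, h⟩

lemma stalkFunctor_map_germ {F G : Cᵒᵖ ⥤ Type w} (φ : F ⟶ G) (E : P)
    (x : F.obj (op (ι.obj E))) :
    (stalkFunctor ι).map φ (germ E x) = germ E (φ.app _ x) :=
  ConcreteCategory.congr_hom (colimit.ι_map (Functor.whiskerLeft ι.op φ) (op E)) x

lemma germ_res {F : Cᵒᵖ ⥤ Type w} {E E' : P} (f : E' ⟶ E) (x : F.obj (op (ι.obj E))) :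
    germ E' (F.map (ι.map f).op x) = germ E x :=
  ConcreteCategory.congr_hom (colimit.w (ι.op ⋙ F) f.op) x

lemma germ_eq_iff [IsCofiltered P] {F : Cᵒᵖ ⥤ Type w} {E E' : P}
    (x : F.obj (op (ι.obj E))) (y : F.obj (op (ι.obj E'))) :
    germ E x = germ E' y ↔ ∃ (D : P) (f : D ⟶ E) (g : D ⟶ E'),
      F.map (ι.map f).op x = F.map (ι.map g).op y := by
  refine (Types.FilteredColimit.colimit_eq_iff (ι.op ⋙ F)).trans ?_
  constructor
  · rintro ⟨D, f, g, h⟩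
    exact ⟨D.unop, f.unop, g.unop, h⟩
  · rintro ⟨D, f, g, h⟩
    exact ⟨op D, f.op, g.op, h⟩

lemma stalk_hom_ext {F : Cᵒᵖ ⥤ Type w} {Y : Type w} {φ ψ : (stalkFunctor ι).obj F ⟶ Y}
    (h : ∀ (E : P) (x : F.obj (op (ι.obj E))), φ (germ E x) = ψ (germ E x)) : φ = ψ := by
  ext s
  obtain ⟨E, x, rfl⟩ := germ_surjective s
  exact h E x

/-- The map from a stalk which is given by compatible maps from the sets of sections. -/
noncomputable def stalkDesc {F : Cᵒᵖ ⥤ Type w} {Y : Type w}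
    (d : ∀ E : P, F.obj (op (ι.obj E)) → Y)
    (hd : ∀ {E E' : P} (f : E' ⟶ E) (x : F.obj (op (ι.obj E))),
      d E' (F.map (ι.map f).op x) = d E x) : (stalkFunctor ι).obj F ⟶ Y :=
  colimit.desc (ι.op ⋙ F)
    { pt := Y
      ι :=
        { app := fun E => ↾(d E.unop)
          naturality := by
            intro E E' f
            ext x
            exact hd f.unop x } }

lemma stalkDesc_germ {F : Cᵒᵖ ⥤ Type w} {Y : Type w}
    (d : ∀ E : P, F.obj (op (ι.obj E)) → Y)
    (hd : ∀ {E E' : P} (f : E' ⟶ E) (x : F.obj (op (ι.obj E))),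
      d E' (F.map (ι.map f).op x) = d E x) (E : P) (x : F.obj (op (ι.obj E))) :
    stalkDesc d hd (germ E x) = d E x :=
  ConcreteCategory.congr_hom (colimit.ι_desc (F := ι.op ⋙ F) _ (op E)) x

lemma skyscraperFunctor_obj_map_apply {Y : Type w} {X X' : C} (f : X' ⟶ X)
    (t : ((skyscraperFunctor ι).obj Y).obj (op X)) :
    (((skyscraperFunctor ι).obj Y).map f.op t : (stalkFunctor ι).obj (yoneda.obj X') ⟶ Y) =
      (stalkFunctor ι).map (yoneda.map f) ≫
        (show (stalkFunctor ι).obj (yoneda.obj X) ⟶ Y from t) :=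
  rfl

/-- The bijection which underlies the adjunction between stalks and skyscrapers. -/
noncomputable def stalkHomEquiv (F : Cᵒᵖ ⥤ Type w) (Y : Type w) :
    ((stalkFunctor ι).obj F ⟶ Y) ≃ (F ⟶ (skyscraperFunctor ι).obj Y) where
  toFun φ :=
    { app := fun X => ↾(fun x =>
        ((stalkFunctor ι).map ((yonedaEquiv (X := X.unop) (F := F)).symm x) ≫ φ :
          (stalkFunctor ι).obj (yoneda.obj X.unop) ⟶ Y))
      naturality := by
        intro X X' f
        ext x
        change (stalkFunctor ι).map (yonedaEquiv.symm (F.map f x)) ≫ φ =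
          (stalkFunctor ι).map (yoneda.map f.unop) ≫
            ((stalkFunctor ι).map (yonedaEquiv.symm x) ≫ φ)
        rw [← Category.assoc, ← Functor.map_comp]
        congr 2
        exact (yonedaEquiv_symm_naturality_left f.unop F x).symm }
  -- As in Yoneda's lemma, `η` is recovered from its values at the tautological germs of the
  -- identities.
  invFun η := stalkDesc
    (fun E x => (show (stalkFunctor ι).obj (yoneda.obj (ι.obj E)) ⟶ Y from η.app _ x)
      (germ E (𝟙 (ι.obj E)))) (by
        intro E E' f x
        have h := ConcreteCategory.congr_hom (η.naturality (ι.map f).op) x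
        change η.app _ (F.map (ι.map f).op x) = ((skyscraperFunctor ι).obj Y).map _ (η.app _ x) at h
        rw [h, skyscraperFunctor_obj_map_apply]
        change _ = (show (stalkFunctor ι).obj (yoneda.obj (ι.obj E)) ⟶ Y from η.app _ x) _
        rw [← germ_res f, ConcreteCategory.comp_apply, stalkFunctor_map_germ]
        congr 2
        exact (Category.id_comp _).trans (Category.comp_id _).symm)
  left_inv φ := by
    refine stalk_hom_ext fun E x => ?_
    rw [stalkDesc_germ]
    change ((stalkFunctor ι).map (yonedaEquiv.symm x) ≫ φ) (germ E (𝟙 (ι.obj E))) = _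
    rw [ConcreteCategory.comp_apply, stalkFunctor_map_germ]
    congr 2
    exact ConcreteCategory.congr_hom (F.map_id _) x
  right_inv η := by
    ext X x
    refine stalk_hom_ext (ι := ι) fun E (a : ι.obj E ⟶ X.unop) => ?_
    change ((stalkFunctor ι).map (yonedaEquiv.symm x) ≫ stalkDesc _ _) (germ E a) = _
    rw [ConcreteCategory.comp_apply, stalkFunctor_map_germ, stalkDesc_germ]
    have h := ConcreteCategory.congr_hom (η.naturality a.op) x
    change η.app _ (F.map a.op x) = ((skyscraperFunctor ι).obj Y).map _ (η.app _ x) at h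
    change (show (stalkFunctor ι).obj (yoneda.obj (ι.obj E)) ⟶ Y from
      η.app _ (F.map a.op x)) _ = _
    rw [h, skyscraperFunctor_obj_map_apply, ConcreteCategory.comp_apply, stalkFunctor_map_germ]
    change (show (stalkFunctor ι).obj (yoneda.obj X.unop) ⟶ Y from η.app _ x) (germ E _) =
      (show (stalkFunctor ι).obj (yoneda.obj X.unop) ⟶ Y from η.app _ x) (germ E _)
    congr 2
    exact Category.id_comp a

lemma stalkHomEquiv_naturality_left {F G : Cᵒᵖ ⥤ Type w} {Y : Type w} (f : F ⟶ G)
    (φ : (stalkFunctor ι).obj G ⟶ Y) :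
    stalkHomEquiv F Y ((stalkFunctor ι).map f ≫ φ) = f ≫ stalkHomEquiv G Y φ := by
  ext X x
  change (stalkFunctor ι).map (yonedaEquiv.symm x) ≫ (stalkFunctor ι).map f ≫ φ =
    (stalkFunctor ι).map (yonedaEquiv.symm (f.app X x)) ≫ φ
  rw [← Category.assoc, ← Functor.map_comp]
  congr 2
  apply yonedaEquiv.injective
  rw [Equiv.apply_symm_apply]
  exact (yonedaEquiv_comp _ _).trans
    (congrArg (f.app X) ((yonedaEquiv (X := X.unop) (F := F)).apply_symm_apply x))

instance stalkFunctor_preservesFiniteLimits [IsCofiltered P] :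
    PreservesFiniteLimits (stalkFunctor ι) := by
  unfold stalkFunctor
  exact comp_preservesFiniteLimits _ _

/-- If every covering morphism to some `ι(E)` is dominated by a transition morphism of the
diagram, then inclusions of covering sieves are sent to bijections. -/
lemma stalkFunctor_map_functorInclusion_bijective [IsCofiltered P] {J : GrothendieckTopology C}
    (hlift : ∀ (E : P) (S : Sieve (ι.obj E)), S ∈ J (ι.obj E) →
      ∃ (E' : P) (u : E' ⟶ E), S (ι.map u)) {X : C} (R : Sieve X) (hR : R ∈ J X) :
    Function.Bijective ((stalkFunctor ι).map R.functorInclusion) := by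
  constructor
  · intro s t h
    obtain ⟨E, x, rfl⟩ := germ_surjective s
    obtain ⟨E', y, rfl⟩ := germ_surjective t
    rw [stalkFunctor_map_germ, stalkFunctor_map_germ, germ_eq_iff] at h
    obtain ⟨D, f, g, h⟩ := h
    rw [germ_eq_iff]
    exact ⟨D, f, g, Subtype.ext h⟩
  · intro s
    obtain ⟨E, a, rfl⟩ := germ_surjective s
    -- The germ of `a` is also that of `ι(u) ≫ a`, which lies in `R`.
    obtain ⟨E', u, hu⟩ := hlift E (R.pullback a) (J.pullback_stable a hR)
    let b : R.functor.obj (op (ι.obj E')) := ⟨ι.map u ≫ a, hu⟩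
    refine ⟨germ E' b, ?_⟩
    rw [stalkFunctor_map_germ, ← germ_res u]
    rfl

/-- By adjunction, extending a map from `R` to the representable presheaf amounts to extending a map
between stalks, where the inclusion of `R` is invertible. -/
lemma isSheaf_skyscraperFunctor_obj [IsCofiltered P] {J : GrothendieckTopology C}
    (hlift : ∀ (E : P) (S : Sieve (ι.obj E)), S ∈ J (ι.obj E) →
      ∃ (E' : P) (u : E' ⟶ E), S (ι.map u)) (Y : Type w) :
    Presheaf.IsSheaf J ((skyscraperFunctor ι).obj Y) := by
  rw [isSheaf_iff_isSheaf_of_type]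
  intro X R hR
  rw [Presieve.isSheafFor_iff_yonedaSheafCondition]
  intro f
  have : IsIso ((stalkFunctor ι).map R.functorInclusion) :=
    (isIso_iff_bijective _).2 (stalkFunctor_map_functorInclusion_bijective hlift R hR)
  obtain ⟨φ, rfl⟩ := (stalkHomEquiv _ _).surjective f
  refine ⟨stalkHomEquiv _ _ (inv ((stalkFunctor ι).map R.functorInclusion) ≫ φ), ?_, ?_⟩
  · dsimp only
    rw [← stalkHomEquiv_naturality_left, IsIso.hom_inv_id_assoc]
  · intro g hg
    obtain ⟨ψ, rfl⟩ := (stalkHomEquiv _ _).surjective g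
    rw [← stalkHomEquiv_naturality_left] at hg
    rw [← (stalkHomEquiv _ _).injective hg, IsIso.inv_hom_id_assoc]

/-- The adjunction between stalks of sheaves and skyscraper sheaves. -/
noncomputable def sheafStalkAdjunction {J : GrothendieckTopology C}
    (h : ∀ Y : Type w, Presheaf.IsSheaf J ((skyscraperFunctor ι).obj Y)) :
    sheafToPresheaf J (Type w) ⋙ stalkFunctor ι ⊣
      (ObjectProperty.lift _ (skyscraperFunctor ι) h : Type w ⥤ Sheaf J (Type w)) :=
  Adjunction.mkOfHomEquiv
    { homEquiv := fun F Y => (stalkHomEquiv F.obj Y).trans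
        ((fullyFaithfulSheafToPresheaf J (Type w)).homEquiv (X := F)
          (Y := ⟨(skyscraperFunctor ι).obj Y, h Y⟩)).symm
      homEquiv_naturality_left_symm := by
        intro F G Y f g
        apply (stalkHomEquiv F.obj Y).injective
        erw [stalkHomEquiv_naturality_left]
        simp
        rfl
      homEquiv_naturality_right := by
        intro F Y Y' f g
        rfl }

/-- The point of the topos of sheaves given by a cofiltered diagram. -/
noncomputable def stalkPoint [IsCofiltered P] (J : GrothendieckTopology C)
    (hlift : ∀ (E : P) (S : Sieve (ι.obj E)), S ∈ J (ι.obj E) →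
      ∃ (E' : P) (u : E' ⟶ E), S (ι.map u)) : ToposPoint.{w} (Sheaf J (Type w)) where
  inverseImage := sheafToPresheaf J (Type w) ⋙ stalkFunctor ι
  directImage := ObjectProperty.lift _ (skyscraperFunctor ι) (isSheaf_skyscraperFunctor_obj hlift)
  adj := sheafStalkAdjunction _
  preservesFiniteLimits := comp_preservesFiniteLimits _ _

end Stalk

/-! ### Covering morphisms -/

section Covering

variable {C : Type u} [Category.{w} C] {J : GrothendieckTopology C}

lemma coveringMorphisms_of_mem {T : MorphismProperty C}
    (hT : ∀ (X : C) (R : Sieve X), R ∈ J X ↔ ∃ (Y : C) (f : Y ⟶ X), R f ∧ T f)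
    {X Y : C} {f : Y ⟶ X} (hf : T f) : coveringMorphisms J f :=
  (hT _ _).2 ⟨Y, f, Sieve.le_generate _ _ _ (Presieve.singleton_self f), hf⟩

/-- The collection `T` that witnesses an `A`-topology is contained in `𝒯(J)`. -/
lemma IsATopology.exists_mem (hJ : IsATopology J) {X : C} {R : Sieve X} (hR : R ∈ J X) :
    ∃ (Y : C) (f : Y ⟶ X), R f ∧ coveringMorphisms J f := by
  obtain ⟨T, -, hT⟩ := hJ
  obtain ⟨Y, f, hf, hf'⟩ := (hT _ _).1 hR
  exact ⟨Y, f, hf, coveringMorphisms_of_mem hT hf'⟩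

lemma IsATopology.ore (hJ : IsATopology J) {X Y Y' : C} (f : Y ⟶ X) (f' : Y' ⟶ X)
    (hf : coveringMorphisms J f) :
    ∃ (Z : C) (g : Z ⟶ Y) (g' : Z ⟶ Y'), coveringMorphisms J g' ∧ g ≫ f = g' ≫ f' := by
  obtain ⟨Z, g', ⟨_, g, _, ⟨⟩, h⟩, hg'⟩ := hJ.exists_mem (J.pullback_stable f' hf)
  exact ⟨Z, g, g', hg', h⟩

/-- A cospan of covering morphisms can be completed to a square of covering morphisms. -/
lemma IsBSite.ore (hJ : IsBSite J) {X Y Y' : C} (f : Y ⟶ X) (f' : Y' ⟶ X)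
    (hf : coveringMorphisms J f) (hf' : coveringMorphisms J f') :
    ∃ (Z : C) (g : Z ⟶ Y) (g' : Z ⟶ Y'),
      coveringMorphisms J g ∧ coveringMorphisms J g' ∧ g ≫ f = g' ≫ f' := by
  obtain ⟨Z, g, g', hg', h⟩ := hJ.isATopology.ore f f' hf
  have := (coveringMorphisms J).comp_mem _ _ hg' hf'
  rw [← h] at this
  exact ⟨Z, g, g', ((hJ.comp_mem_iff _ _).1 this).2, hg', h⟩

/-- Restriction of sections of a sheaf along a covering morphism is injective. -/
lemma injective_map_of_coveringMorphisms (F : Sheaf J (Type w)) {X Y : C} {f : Y ⟶ X}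
    (hf : coveringMorphisms J f) : Function.Injective (F.obj.map f.op) := by
  intro s t h
  have hF := (isSheaf_iff_isSheaf_of_type _ _).1 F.property _ hf
  refine hF.isSeparatedFor.ext ?_
  rintro Z _ ⟨_, g, _, ⟨⟩, rfl⟩
  simp only [op_comp, Functor.map_comp, ConcreteCategory.comp_apply, h]

lemma exists_amalgamation_of_coveringMorphisms (F : Sheaf J (Type w)) {X Y : C} {f : Y ⟶ X}
    (hf : coveringMorphisms J f) (t : F.obj.obj (op Y))
    (ht : ∀ {Z : C} (a b : Z ⟶ Y), a ≫ f = b ≫ f → F.obj.map a.op t = F.obj.map b.op t) :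
    ∃ s, F.obj.map f.op s = t := by
  have hF := (isSheaf_iff_isSheaf_of_type _ _).1 F.property _ hf
  rw [← Presieve.isSheafFor_iff_generate] at hF
  let x : Presieve.FamilyOfElements F.obj (Presieve.singleton f) :=
    -- The family is just `t`: membership in the singleton forces `Z = Y`.
    fun Z g hg => F.obj.map (eqToHom (by cases hg; rfl)).op t
  have hx : x.Compatible := by
    rintro Z₁ Z₂ W g₁ g₂ _ _ ⟨⟩ ⟨⟩ h
    simpa [x] using ht _ _ h
  obtain ⟨s, hs, -⟩ := hF x hx
  exact ⟨s, by simpa [x] using hs f (Presieve.singleton_self f)⟩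

/-! ### Conservativity of stalks along diagrams of covering morphisms -/

variable {P : Type w} [SmallCategory P] [IsCofiltered P] {ι : P ⥤ C}

lemma germ_injective (hι : ∀ {E E' : P} (u : E' ⟶ E), coveringMorphisms J (ι.map u))
    (F : Sheaf J (Type w)) (E : P) :
    Function.Injective (germ (ι := ι) (F := F.obj) E) := by
  intro s t h
  obtain ⟨D, u, v, h⟩ := (germ_eq_iff s t).1 h
  -- Equalizing `u` and `v` turns the two restrictions into one, along a covering morphism.
  obtain ⟨D', k, hk⟩ := IsCofilteredOrEmpty.cone_maps u v
  refine injective_map_of_coveringMorphisms F (hι (k ≫ u)) ?_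
  conv_rhs => rw [hk]
  simp only [Functor.map_comp, op_comp, ConcreteCategory.comp_apply, h]

/-- A morphism of sheaves which is bijective on a stalk is injective on the sections over
the objects covered by the diagram. -/
lemma injective_app_of_stalk (hι : ∀ {E E' : P} (u : E' ⟶ E), coveringMorphisms J (ι.map u))
    {F G : Sheaf J (Type w)} (φ : F ⟶ G)
    (hφ : Function.Injective ((stalkFunctor ι).map φ.hom)) {X : C} {E : P} (f : ι.obj E ⟶ X)
    (hf : coveringMorphisms J f) : Function.Injective (φ.hom.app (op X)) := by
  intro s t h
  apply injective_map_of_coveringMorphisms F hf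
  apply germ_injective hι F E
  apply hφ
  rw [stalkFunctor_map_germ, stalkFunctor_map_germ]
  have h₁ := ConcreteCategory.congr_hom (φ.hom.naturality f.op)
  simp only [ConcreteCategory.comp_apply] at h₁
  rw [h₁, h₁, h]

lemma exists_local_preimage_of_stalk
    (hι : ∀ {E E' : P} (u : E' ⟶ E), coveringMorphisms J (ι.map u))
    {F G : Sheaf J (Type w)} (φ : F ⟶ G)
    (hφ : Function.Surjective ((stalkFunctor ι).map φ.hom)) {X : C} {E : P} (f : ι.obj E ⟶ X)
    (hf : coveringMorphisms J f) (s : G.obj.obj (op X)) :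
    ∃ (Y : C) (g : Y ⟶ X) (t : F.obj.obj (op Y)), coveringMorphisms J g ∧
      φ.hom.app _ t = G.obj.map g.op s := by
  obtain ⟨y, hy⟩ := hφ (germ E (G.obj.map f.op s))
  obtain ⟨E', t, rfl⟩ := germ_surjective y
  rw [stalkFunctor_map_germ, germ_eq_iff] at hy
  obtain ⟨D, u, v, h⟩ := hy
  refine ⟨ι.obj D, ι.map v ≫ f, F.obj.map (ι.map u).op t,
    (coveringMorphisms J).comp_mem _ _ (hι v) hf, ?_⟩
  have h₁ := ConcreteCategory.congr_hom (φ.hom.naturality (ι.map u).op) t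
  simp only [ConcreteCategory.comp_apply] at h₁
  rw [h₁, h]
  simp only [Functor.map_comp, op_comp, ConcreteCategory.comp_apply]

/-- Injectivity makes local preimages unique, so they satisfy the gluing condition and descend. -/
lemma isIso_of_injective_of_locallySurjective {F G : Sheaf J (Type w)} (φ : F ⟶ G)
    (hinj : ∀ X : C, Function.Injective (φ.hom.app (op X)))
    (hsurj : ∀ (X : C) (s : G.obj.obj (op X)), ∃ (Y : C) (g : Y ⟶ X) (t : F.obj.obj (op Y)),
      coveringMorphisms J g ∧ φ.hom.app _ t = G.obj.map g.op s) : IsIso φ := by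
  have : IsIso ((sheafToPresheaf J (Type w)).map φ) := by
    rw [NatTrans.isIso_iff_isIso_app]
    rintro ⟨X⟩
    rw [isIso_iff_bijective]
    refine ⟨hinj X, fun s => ?_⟩
    have nat : ∀ {U V : C} (f : V ⟶ U) (x : F.obj.obj (op U)),
        φ.hom.app _ (F.obj.map f.op x) = G.obj.map f.op (φ.hom.app _ x) := fun f x =>
      ConcreteCategory.congr_hom (φ.hom.naturality f.op) x
    obtain ⟨Y, g, t, hg, ht⟩ := hsurj X s
    obtain ⟨r, hr⟩ := exists_amalgamation_of_coveringMorphisms F hg t (by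
      intro Z a b hab
      apply hinj
      rw [nat, nat, ht]
      simp only [← ConcreteCategory.comp_apply, ← Functor.map_comp, ← op_comp, hab])
    refine ⟨r, injective_map_of_coveringMorphisms G hg ?_⟩
    change G.obj.map g.op (φ.hom.app _ r) = _
    rw [← nat, hr, ht]
  exact isIso_of_reflects_iso φ (sheafToPresheaf J (Type w))

end Covering

/-! ### Normal coverings -/

section Normal

variable {C : Type u} [Category.{w} C]

/-- A morphism `e : Y ⟶ X` is normal if any two morphisms to `Y` which agree over `X` differ by
an endomorphism of `Y` over `X`. -/
def IsNormalMorphism {X Y : C} (e : Y ⟶ X) : Prop :=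
  ∀ ⦃Z : C⦄ (a b : Z ⟶ Y), a ≫ e = b ≫ e → ∃ σ : Y ⟶ Y, a ≫ σ = b ∧ σ ≫ e = e

lemma IsGaloisCovering.isNormalMorphism {X Y : C} {e : Y ⟶ X} (he : IsGaloisCovering e) :
    IsNormalMorphism e := by
  obtain ⟨G, _, ρ, h⟩ := he
  intro Z a b hab
  obtain ⟨g, hg⟩ := @IsPseudoTorsor.injective G _ _ _ (homMulAction ρ Z) _ (h Z) a b hab
  exact ⟨(ρ g).hom.left, hg, Over.w (ρ g).hom⟩

lemma IsNormalMorphism.iso_comp {X Y Y' : C} {e : Y ⟶ X} (he : IsNormalMorphism e)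
    (i : Y' ≅ Y) : IsNormalMorphism (i.hom ≫ e) := by
  intro Z a b hab
  obtain ⟨σ, h₁, h₂⟩ := he (a ≫ i.hom) (b ≫ i.hom) (by simpa using hab)
  refine ⟨i.hom ≫ σ ≫ i.inv, ?_, by simp [h₂]⟩
  rw [← cancel_mono i.hom]
  simpa using h₁

variable {J : GrothendieckTopology C}

lemma IsBSite.coveringMorphisms_of_comp (hJ : IsBSite J) {X Y Z : C} {g : Z ⟶ Y} {f : Y ⟶ X}
    (h : coveringMorphisms J (g ≫ f)) : coveringMorphisms J g :=
  ((hJ.comp_mem_iff _ _).1 h).2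

/-- Two morphisms over `X` from a normal covering of `X` differ by an endomorphism of
their source. -/
lemma IsNormalMorphism.exists_comp_eq (hJ : IsBSite J) {X Y Y' : C} {e : Y ⟶ X} {e' : Y' ⟶ X}
    (he : coveringMorphisms J e) (hn : IsNormalMorphism e) (p q : Y ⟶ Y')
    (hp : p ≫ e' = e) (hq : q ≫ e' = e) : ∃ σ : Y ⟶ Y, σ ≫ q = p := by
  obtain ⟨Z, a, b, ha, -, h⟩ := hJ.ore p q
    (hJ.coveringMorphisms_of_comp (by rwa [hp])) (hJ.coveringMorphisms_of_comp (by rwa [hq]))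
  obtain ⟨σ, rfl, -⟩ := hn a b (by
    conv_lhs => rw [← hp, reassoc_of% h, hq])
  have := hJ.epi a
  refine ⟨σ, ?_⟩
  rw [← cancel_epi a, h, Category.assoc]

/-! ### Cofiltered diagrams of normal coverings -/

/-- Coinitiality only gives some morphism over `X` from a later stage to `K(E)` that lies in `S`.
Since that stage is normal, the transition morphism differs from it by precomposition with an
endomorphism, hence lies in `S` too. -/
lemma exists_map_eq_of_normal (hJ : IsBSite J) {P : Type w} [SmallCategory P] [IsCofiltered P]
    {X : C} (K : P ⥤ Over X) (hK : ∀ E, coveringMorphisms J (K.obj E).hom)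
    (hn : ∀ E, IsNormalMorphism (K.obj E).hom)
    (hc : ∀ {Y : C} (f : Y ⟶ X), coveringMorphisms J f → ∃ E, Nonempty (K.obj E ⟶ Over.mk f))
    (E : P) (S : Sieve (K.obj E).left) (hS : S ∈ J _) :
    ∃ (E' : P) (u : E' ⟶ E), S (K.map u).left := by
  obtain ⟨Y, f, hSf, hf⟩ := hJ.isATopology.exists_mem hS
  obtain ⟨E₁, ⟨a⟩⟩ := hc (f ≫ (K.obj E).hom) ((coveringMorphisms J).comp_mem _ _ hf (hK E))
  obtain ⟨D, u, v, -⟩ := IsCofilteredOrEmpty.cone_objs E E₁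
  have ha : a.left ≫ f ≫ (K.obj E).hom = (K.obj E₁).hom := Over.w a
  obtain ⟨σ, hσ⟩ := (hn D).exists_comp_eq hJ (hK D) (K.map u).left ((K.map v).left ≫ a.left ≫ f)
    (Over.w _) (by rw [Category.assoc, Category.assoc, ha]; exact Over.w _)
  refine ⟨D, u, ?_⟩
  rw [← hσ]
  simpa only [Category.assoc] using S.downward_closed hSf (σ ≫ (K.map v).left ≫ a.left)

/-- A (`w`-small) type of normal coverings of `X`. -/
structure NormalCovering (J : GrothendieckTopology C) [EssentiallySmall.{w} C] (X : C) where
  obj : SmallModel.{w} C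
  hom : (equivSmallModel.{w} C).inverse.obj obj ⟶ X
  covering : coveringMorphisms J hom
  normal : IsNormalMorphism hom

/-! ### The directed preorder of normal coverings and compatible choices of morphisms -/

namespace NormalCovering

variable [EssentiallySmall.{w} C] {X : C}

/-- A normal covering of `X`, as an object over `X`. -/
noncomputable abbrev toOver (N : NormalCovering J X) : Over X := Over.mk N.hom

/-- Finer coverings are larger, so that directedness means common refinement. -/
instance : Preorder (NormalCovering J X) where
  le M N := Nonempty (N.toOver ⟶ M.toOver)
  le_refl _ := ⟨𝟙 _⟩
  le_trans := by
    rintro _ _ _ ⟨f⟩ ⟨g⟩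
    exact ⟨g ≫ f⟩

/-- Having enough Galois coverings refines `f` to a Galois covering in `𝒯(J)`; its source is then
moved into the small model. -/
lemma exists_hom (hJ : IsYSite J) {Y : C} (f : Y ⟶ X) (hf : coveringMorphisms J f) :
    ∃ N : NormalCovering J X, Nonempty (N.toOver ⟶ Over.mk f) := by
  have hf' : dominated (coveringMorphisms J) f := ⟨Y, 𝟙 Y, by rwa [Category.id_comp]⟩
  rw [← hJ.enoughGalois] at hf'
  obtain ⟨Z, g, hg, hg'⟩ := hf'
  let i : (equivSmallModel.{w} C).inverse.obj ((equivSmallModel.{w} C).functor.obj Z) ≅ Z :=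
    (equivSmallModel.{w} C).unitIso.symm.app Z
  have hi : coveringMorphisms J i.hom := hJ.coveringMorphisms_of_comp (f := i.inv) (by
    rw [i.hom_inv_id]
    exact (coveringMorphisms J).id_mem _)
  exact ⟨⟨_, i.hom ≫ g ≫ f, (coveringMorphisms J).comp_mem _ _ hi hg,
    hg'.isNormalMorphism.iso_comp i⟩, ⟨Over.homMk (i.hom ≫ g) (by simp)⟩⟩

lemma nonempty (hJ : IsYSite J) : Nonempty (NormalCovering J X) :=
  ⟨(exists_hom hJ (𝟙 X) ((coveringMorphisms J).id_mem X)).choose⟩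

/-- Any normal covering and any covering morphism are dominated by a normal covering. -/
lemma exists_le_and_hom (hJ : IsYSite J) (N : NormalCovering J X) {Y : C} (f : Y ⟶ X)
    (hf : coveringMorphisms J f) :
    ∃ M : NormalCovering J X, N ≤ M ∧ Nonempty (M.toOver ⟶ Over.mk f) := by
  obtain ⟨Z, g, g', hg, -, h⟩ := hJ.toIsBSite.ore N.hom f N.covering hf
  obtain ⟨M, ⟨a⟩⟩ := exists_hom hJ (g ≫ N.hom)
    ((coveringMorphisms J).comp_mem _ _ hg N.covering)
  exact ⟨M, ⟨a ≫ Over.homMk g rfl⟩, ⟨a ≫ Over.homMk g' h.symm⟩⟩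

lemma isDirected (hJ : IsYSite J) : IsDirectedOrder (NormalCovering J X) where
  directed M N := by
    obtain ⟨L, h, ⟨a⟩⟩ := exists_le_and_hom hJ M N.hom N.covering
    exact ⟨L, h, ⟨a⟩⟩

/-- If `T` dominates the normal coverings `M` and `N` of `X`, and there is a morphism `N ⟶ M`,
then there is such a morphism which is compatible with given morphisms from `T`. -/
lemma exists_comp_eq {T M N : NormalCovering J X} (f : T.toOver ⟶ N.toOver)
    (g : T.toOver ⟶ M.toOver) (k : N.toOver ⟶ M.toOver) :
    ∃ k' : N.toOver ⟶ M.toOver, f ≫ k' = g := by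
  obtain ⟨σ, h₁, h₂⟩ := M.normal (f.left ≫ k.left) g.left (by
    rw [Category.assoc, show k.left ≫ M.hom = N.hom from Over.w k,
      show f.left ≫ N.hom = T.hom from Over.w f, show g.left ≫ M.hom = T.hom from Over.w g])
  exact ⟨k ≫ Over.homMk σ h₂, by ext; simpa using h₁⟩

lemma epi_hom (hJ : IsYSite J) {M N : NormalCovering J X} (f : N.toOver ⟶ M.toOver) : Epi f := by
  have : Epi ((Over.forget X).map f) := hJ.epi f.left
  exact (Over.forget X).epi_of_epi_map this

/-- Any morphism over `X` between coverings of `X` is itself covering, so the finiteness assumed in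
`𝒞(𝒯(J))` over `X` applies. -/
lemma finite_hom (hJ : IsYSite J)
    (hX : HasFiniteHoms (Over (⟨X⟩ : CoveringCategory J))) (M N : NormalCovering J X) :
    Finite (N.toOver ⟶ M.toOver) := by
  let O (L : NormalCovering J X) : Over (⟨X⟩ : CoveringCategory J) :=
    Over.mk (Y := ⟨_⟩) ⟨L.hom, L.covering⟩
  have := hX (O N) (O M)
  let φ (f : N.toOver ⟶ M.toOver) : O N ⟶ O M :=
    Over.homMk ⟨f.left, hJ.coveringMorphisms_of_comp (f := M.hom) (by
      rw [show f.left ≫ M.hom = N.hom from Over.w f]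
      exact N.covering)⟩ (by
        apply WideSubcategory.hom_ext
        exact Over.w f)
  refine Finite.of_injective φ fun f g h => ?_
  ext
  exact congrArg (fun a : O N ⟶ O M => a.left.hom) h

/-- Finiteness of the sets of morphisms allows to choose a compatible system of morphisms
between all normal coverings. -/
lemma exists_functor_of_finite (hJ : IsYSite J)
    (hX : HasFiniteHoms (Over (⟨X⟩ : CoveringCategory J))) :
    ∃ K : (NormalCovering J X)ᵒᵖ ⥤ Over X, ∀ N, K.obj N = N.unop.toOver := by
  have := nonempty (X := X) hJ
  have := isDirected (X := X) hJ
  let U : Ultrafilter (NormalCovering J X) := Ultrafilter.of Filter.atTop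
  have hU (N : NormalCovering J X) : ∀ᶠ T in U, N ≤ T :=
    Ultrafilter.of_le _ (Filter.eventually_ge_atTop N)
  let t {N T : NormalCovering J X} (h : N ≤ T) : T.toOver ⟶ N.toOver := h.some
  -- For each `T` beyond `N`, normality of `M` gives a `p` compatible with the arbitrary choices
  -- `t`. There are finitely many candidates, so the ultrafilter selects one that works for almost
  -- all `T`.
  have key {M N : NormalCovering J X} (h : M ≤ N) : ∃ p : N.toOver ⟶ M.toOver,
      ∀ᶠ T in U, ∀ (hM : M ≤ T) (hN : N ≤ T), t hN ≫ p = t hM := by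
    have := finite_hom hJ hX M N
    rw [← Ultrafilter.eventually_exists_iff]
    filter_upwards [hU N] with T hT
    obtain ⟨p, hp⟩ := exists_comp_eq (t hT) (t (h.trans hT)) h.some
    exact ⟨p, fun _ _ => hp⟩
  choose p hp using @key
  refine ⟨{ obj := fun N => N.unop.toOver
            map := fun f => p f.unop.le
            map_id := fun N => ?_
            map_comp := fun {L M N} f g => ?_ }, fun _ => rfl⟩
  -- Functoriality is tested at one `T` for which all the compatibilities involved hold, then `t hT`
  -- is cancelled as an epimorphism.
  · obtain ⟨T, h, hT⟩ := ((hp (le_refl N.unop)).and (hU N.unop)).exists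
    have := epi_hom hJ (t hT)
    rw [← cancel_epi (t hT)]
    exact (h hT hT).trans (Category.comp_id _).symm
  · obtain ⟨T, ⟨⟨h₁, h₂⟩, h₃⟩, hT⟩ := (((hp f.unop.le).and (hp g.unop.le)).and
      (hp (f ≫ g).unop.le)).and (hU L.unop) |>.exists
    have hM := f.unop.le.trans hT
    have hN := g.unop.le.trans hM
    have := epi_hom hJ (t hT)
    rw [← cancel_epi (t hT), h₃ hN hT, ← Category.assoc, h₁ hM hT, h₂ hN hM]

/-- A countable coinitial set gives a coinitial sequence of normal coverings. -/
lemma exists_sequence_of_countable (hJ : IsYSite J)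
    (hX : HasCountableCoinitialSet (Over (⟨X⟩ : CoveringCategory J))) :
    ∃ N : ℕ → NormalCovering J X, (∀ n, N n ≤ N (n + 1)) ∧
      ∀ {Y : C} (f : Y ⟶ X), coveringMorphisms J f → ∃ n, Nonempty ((N n).toOver ⟶ Over.mk f) := by
  obtain ⟨S, hS, hS'⟩ := hX
  obtain ⟨Y₀, hY₀, -⟩ := hS' (Over.mk (𝟙 _))
  obtain ⟨s, rfl⟩ := hS.exists_eq_range ⟨Y₀, hY₀⟩
  choose F hF hF' using fun (n : ℕ) (N : NormalCovering J X) =>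
    exists_le_and_hom hJ N (s n).hom.hom (s n).hom.property
  refine ⟨fun n => Nat.rec (nonempty hJ).some F n, fun n => hF _ _, fun {Y} f hf => ?_⟩
  obtain ⟨_, ⟨n, rfl⟩, ⟨a⟩⟩ := hS' (Over.mk (Y := ⟨Y⟩) ⟨f, hf⟩)
  -- Term `n + 1` was built to dominate `s n`.
  refine ⟨n + 1, ⟨(hF' n _).some ≫ Over.homMk a.left.hom ?_⟩⟩
  exact congrArg (fun b => b.hom) (Over.w a)

end NormalCovering

/-- Under either of the cardinality conditions, there is a coinitial cofiltered diagram
of normal coverings of `X`. -/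
lemma exists_coinitial_diagram (hJ : IsYSite J) (X : C)
    (hX : HasFiniteHoms (Over (⟨X⟩ : CoveringCategory J)) ∨
      HasCountableCoinitialSet (Over (⟨X⟩ : CoveringCategory J))) :
    ∃ (P : Type w) (_ : SmallCategory P) (_ : IsCofiltered P) (K : P ⥤ Over X),
      (∀ E, coveringMorphisms J (K.obj E).hom) ∧ (∀ E, IsNormalMorphism (K.obj E).hom) ∧
      ∀ {Y : C} (f : Y ⟶ X), coveringMorphisms J f →
        ∃ E, Nonempty (K.obj E ⟶ Over.mk f) := by
  have := hJ.essentiallySmall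
  rcases hX with hX | hX
  · have := NormalCovering.nonempty (X := X) hJ
    have := NormalCovering.isDirected (X := X) hJ
    obtain ⟨K, hK⟩ := NormalCovering.exists_functor_of_finite hJ hX
    refine ⟨(NormalCovering J X)ᵒᵖ, inferInstance, inferInstance, K, fun E => ?_, fun E => ?_,
      fun f hf => ?_⟩
    · rw [hK]
      exact E.unop.covering
    · rw [hK]
      exact E.unop.normal
    · obtain ⟨N, ⟨a⟩⟩ := NormalCovering.exists_hom hJ f hf
      exact ⟨op N, ⟨eqToHom (hK _) ≫ a⟩⟩
  · obtain ⟨N, hN, hc⟩ := NormalCovering.exists_sequence_of_countable hJ hX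
    let K : ℕᵒᵖ ⥤ Over X := Functor.ofOpSequence (X := fun n => (N n).toOver)
      fun n => (hN n).some
    let d : ULift.{w} ℕ ⥤ ℕ := Monotone.functor (f := ULift.down) fun _ _ h => h
    refine ⟨(ULift.{w} ℕ)ᵒᵖ, inferInstance, inferInstance, d.op ⋙ K, fun E => ?_, fun E => ?_,
      fun f hf => ?_⟩
    · exact (N E.unop.down).covering
    · exact (N E.unop.down).normal
    · obtain ⟨n, ⟨a⟩⟩ := hc f hf
      exact ⟨op ⟨n⟩, ⟨a⟩⟩

end Normal

/-! ### Edge objects of a grid -/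

section Grid

variable {C : Type u} [Category.{w} C] {J : GrothendieckTopology C} {C₀ : Type w}
  [PartialOrder C₀] {ι₀ : C₀ ⥤ C}

lemma edgeObjects_of_hom (hJ : IsBSite J) {X Y : C₀} (f : Y ⟶ X) (hX : edgeObjects J ι₀ X) :
    edgeObjects J ι₀ Y := fun Z g =>
  hJ.coveringMorphisms_of_comp (f := ι₀.map f) (by
    rw [← ι₀.map_comp]
    exact hX Z _)

lemma IsGrid.isCofiltered_edgeObjects [Nonempty C] (hJ : IsBSite J) (h : IsGrid J ι₀) :
    IsCofiltered (edgeObjects J ι₀).FullSubcategory where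
  nonempty := by
    obtain ⟨X, hX, -⟩ := h.exists_edge (Classical.arbitrary C)
    exact ⟨⟨X, hX⟩⟩
  cone_objs := by
    rintro ⟨X, hX⟩ ⟨Y, hY⟩
    obtain ⟨Z, ⟨f⟩, ⟨g⟩⟩ := h.isLambdaConnected X Y
    exact ⟨⟨Z, edgeObjects_of_hom hJ f hX⟩, ObjectProperty.homMk f, ObjectProperty.homMk g,
      trivial⟩
  cone_maps := by
    intro X Y f g
    exact ⟨X, 𝟙 X, by
      ext
      exact Subsingleton.elim _ _⟩

/-- A covering member of `S` lifts, up to isomorphism, to a morphism of the poset, whose source is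
again an edge object. -/
lemma IsGrid.exists_map_mem (hJ : IsBSite J) (h : IsGrid J ι₀)
    (E : (edgeObjects J ι₀).FullSubcategory)
    (S : Sieve (((edgeObjects J ι₀).ι ⋙ ι₀).obj E))
    (hS : S ∈ J (((edgeObjects J ι₀).ι ⋙ ι₀).obj E)) :
    ∃ (E' : (edgeObjects J ι₀).FullSubcategory) (u : E' ⟶ E),
      S (((edgeObjects J ι₀).ι ⋙ ι₀).map u) := by
  obtain ⟨Y, f, hSf, hf⟩ := hJ.isATopology.exists_mem hS
  obtain ⟨Y', f', α, rfl⟩ := h.exists_lift E.obj Y f hf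
  refine ⟨⟨Y', edgeObjects_of_hom hJ f' E.property⟩, ObjectProperty.homMk f', ?_⟩
  have := S.downward_closed hSf α.inv
  rwa [α.inv_hom_id_assoc] at this

end Grid

/-- Under the cardinality conditions, the topos of sheaves on a `Y`-site has enough points. -/
lemma IsYSite.toposHasEnoughPoints {C : Type u} [Category.{w} C] {J : GrothendieckTopology C}
    (hJ : IsYSite J)
    (hcard : ∀ X : CoveringCategory J,
      HasFiniteHoms (Over X) ∨ HasCountableCoinitialSet (Over X)) :
    ToposHasEnoughPoints.{w} (Sheaf J (Type w)) := by
  have := hJ.essentiallySmall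
  let e := equivSmallModel.{w} C
  choose P hP hP' K hK hn hc using fun X : C => exists_coinitial_diagram hJ X (hcard ⟨X⟩)
  have hmap (X : C) {E E' : P X} (u : E' ⟶ E) :
      coveringMorphisms J ((K X ⋙ Over.forget X).map u) :=
    hJ.coveringMorphisms_of_comp (f := ((K X).obj E).hom) (by
      rw [show (K X ⋙ Over.forget X).map u ≫ ((K X).obj E).hom = ((K X).obj E').hom from
        Over.w ((K X).map u)]
      exact hK X E')
  refine ⟨SmallModel.{w} C, fun S => stalkPoint J (ι := K (e.inverse.obj S) ⋙ Over.forget _)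
    (exists_map_eq_of_normal hJ.toIsBSite _ (hK _) (hn _) (hc _)), ⟨fun {F G} φ hφ => ?_⟩⟩
  have hb (S : SmallModel.{w} C) : Function.Bijective
      ((stalkFunctor (K (e.inverse.obj S) ⋙ Over.forget _)).map φ.hom) :=
    (isIso_iff_bijective _).1 (hφ S)
  have hcover (X : C) : ∃ (S : SmallModel.{w} C) (E : P (e.inverse.obj S))
      (f : (K (e.inverse.obj S) ⋙ Over.forget _).obj E ⟶ X), coveringMorphisms J f := by
    let i : e.inverse.obj (e.functor.obj X) ≅ X := e.unitIso.symm.app X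
    have hi : coveringMorphisms J i.hom := hJ.coveringMorphisms_of_comp (f := i.inv) (by
      rw [i.hom_inv_id]
      exact (coveringMorphisms J).id_mem _)
    -- Any index `E` will do; the identity only serves to produce one.
    obtain ⟨E, -⟩ := hc (e.inverse.obj (e.functor.obj X)) (𝟙 _) ((coveringMorphisms J).id_mem _)
    exact ⟨_, E, ((K _).obj E).hom ≫ i.hom, (coveringMorphisms J).comp_mem _ _ (hK _ E) hi⟩
  refine isIso_of_injective_of_locallySurjective φ (fun X => ?_) (fun X s => ?_)
  · obtain ⟨S, E, f, hf⟩ := hcover X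
    exact injective_app_of_stalk (hmap _) φ (hb S).1 f hf
  · obtain ⟨S, E, f, hf⟩ := hcover X
    exact exists_local_preimage_of_stalk (hmap _) φ (hb S).2 f hf s

theorem theorem8p6 {C : Type u} [Category.{w} C] (J : GrothendieckTopology C) (hJ : IsYSite J)
    (hcard : ∀ X : CoveringCategory J,
      HasFiniteHoms (Over X) ∨ HasCountableCoinitialSet (Over X)) :
    (∀ [Nonempty C] (C₀ : Type w) [PartialOrder C₀] (ι₀ : C₀ ⥤ C), IsGrid J ι₀ →
      PreservesFiniteLimits (sheafFiberFunctor J ι₀) ∧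
      ∃ h : ∀ Y : Type w, Presheaf.IsSheaf J ((directImagePresheaf J ι₀).obj Y),
        Nonempty (sheafFiberFunctor J ι₀ ⊣ directImageSheaf J ι₀ h) ∧
        ∃ p : ToposPoint.{w} (Sheaf J (Type w)),
          p.inverseImage = sheafFiberFunctor J ι₀ ∧
          p.directImage = directImageSheaf J ι₀ h) ∧
    ToposHasEnoughPoints.{w} (Sheaf J (Type w)) := by
  refine ⟨fun C₀ _ ι₀ h => ?_, hJ.toposHasEnoughPoints hcard⟩
  have := h.isCofiltered_edgeObjects hJ.toIsBSite
  let p := stalkPoint J (h.exists_map_mem hJ.toIsBSite)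
  -- The fiber functor and `F_*` of the grid are definitionally the stalk and skyscraper functors of
  -- the diagram of edge objects.
  exact ⟨p.preservesFiniteLimits,
    isSheaf_skyscraperFunctor_obj (h.exists_map_mem hJ.toIsBSite), ⟨p.adj⟩, p, rfl, rfl⟩
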